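/- Let $F=(F^t)_{t\ge 0}$ be a continuous (forward-complete) semiflow on a metric space $M$, for instance the flow of an ODE $\dot x=f(x)$ on $\mathbb R^d$ or on a forward-invariant subset of it. Let $X\subseteq M$ be compact, $X_0\subseteq M$ a set of initial conditions, $T>0$ and $\lambda\in\mathbb C$. Let $\mathbb X_T$ be the set of trajectories $x_T:[0,T]\to X$, $x_T(t)=F^t(x_0)$, with $x_0\in X_0$ (those staying in $X$ on $[0,T]$), and let $\mathbb Y_T=L^2([0,T];\mathbb C)$. Let $k:X\times X\to\mathbb R$ be a universal kernel, i.e. continuous, symmetric, positive semidefinite, and such that the span of the sections $k(\cdot,x')$, $x'\in X$, is uniformly dense in $C(X,\mathbb R)$. Call $\phi\in C(X,\mathbb C)$ a Koopman eigenfunction with eigenvalue $\lambda$ from $X_0$ if $\phi(x)=e^{-\lambda t}\phi(F^t(x))$ whenever $x\in X_0\cap X$, $t\in[0,T]$ and $F^t(x)\in X$. For $x_T,x_T'\in\mathbb X_T$ let $K^\lambda(x_T,x_T')\in\mathcal B(\mathbb Y_T)$ be the integral operator $$(K^\lambda(x_T,x_T')\beta)(t)=\int_0^T\Big(\int_0^T\!\!\int_0^T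 e^{-\lambda(\tau-t)}\,k\big(x_T(\tau),x_T'(\tau')\big)\,e^{-\lambda^*(\tau'-t')}\,d\tau'\,d\tau\Big)\beta(t')\,dt'.$$ Then: (i) $K^\lambda$ defines an RKHS: there is a Hilbert space $\mathcal H^\lambda$ of functions $\mathbb X_T\to\mathbb Y_T$ with continuous point evaluations whose reproducing kernel is $K^\lambda$, and it is unique up to an isometric isomorphism that preserves the values of the functions. (ii) $K^\lambda$ is universal for the Koopman eigenfunctions with eigenvalue $\lambda$: for every Koopman eigenfunction $\phi\in C(X,\mathbb C)$ with eigenvalue $\lambda$ from $X_0$ and every $\varepsilon>0$ there is a finite sum $h=\sum_j K^\lambda(\cdot,x_T^j)\beta_j$ of kernel sections ($x_T^j\in\mathbb X_T$, $\beta_j\in\mathbb Y_T$) with $|h(x_T)(t)-\phi(x_T(t))|<\varepsilon$ for all $x_T\in\mathbb X_T$ and almost all $t\in[0,T]$. (iii) For all $N$ and all data trajectories $x_T^{(1)},\dots,x_T^{(N)}\in\mathbb X_T$, the space $\{\sum_{i=1}^N K^\lambda(\cdot,x_T^{(i)})\beta_i:\beta_i\in\mathbb Y_T\}$ is Koopman-invariant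 over the data: for every $h$ in it and every $i$, $z=h(x_T^{(i)})$ has a continuous representative with $z(t)=e^{\lambda t}z(0)$ for all $t\in[0,T]$. If moreover $X_0$ is non-recurrent ($F^s(x)=F^t(y)$ with $x,y\in X_0$, $s,t\in[0,T]$ implies $s=t$ and $x=y$), then for every such $h$ there is $\phi\in C(X,\mathbb C)$ with $h(x_T^{(i)})(t)=\phi(x_T^{(i)}(t))$ for all $i$ and almost all $t$, and $\phi$ is a Koopman eigenfunction with eigenvalue $\lambda$ from the set of initial conditions $\{x_T^{(1)}(0),\dots,x_T^{(N)}(0)\}$. -/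

import Mathlib

open MeasureTheory
open scoped NNReal ComplexConjugate

universe u v

namespace KoopmanKernel

/-- The time interval `[0, T]`, with Lebesgue measure as its `volume`. -/
abbrev TimeInterval (T : ℝ) : Type := Set.Icc (0 : ℝ) T

noncomputable instance instMeasureSpaceTimeInterval (T : ℝ) : MeasureSpace (TimeInterval T) :=
  Measure.Subtype.measureSpace

instance instIsFiniteMeasureTimeInterval (T : ℝ) :
    IsFiniteMeasure (volume : Measure (TimeInterval T)) :=
  ⟨by
    rw [Measure.Subtype.volume_univ measurableSet_Icc.nullMeasurableSet]
    exact measure_Icc_lt_top⟩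

/-- The space of output trajectories `L²([0, T]; ℂ)`. -/
abbrev OutputSpace (T : ℝ) : Type := Lp ℂ 2 (volume : Measure (TimeInterval T))

section Dynamics

variable {M : Type*} [TopologicalSpace M]

/-- The time of `[0, T]` as a nonnegative number, the time variable of a semiflow. -/
def TimeInterval.toNNReal {T : ℝ} (t : TimeInterval T) : ℝ≥0 := ⟨t, t.2.1⟩

/-- The space of state trajectories: the curves `t ↦ Fᵗ(x₀)`, `t ∈ [0, T]`, inside `X` that start
from an initial condition `x₀ ∈ X₀`. -/
def trajectorySpace (F : Flow ℝ≥0 M) (T : ℝ) (X X₀ : Set M) : Set C(TimeInterval T, X) :=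
  {γ | ∃ x₀ ∈ X₀, ∀ t, (γ t : M) = F t.toNNReal x₀}

/-- `X₀` is non-recurrent over the time interval `[0, T]`: the flow issued from `X₀` does not
intersect itself. -/
def IsNonRecurrent (F : Flow ℝ≥0 M) (T : ℝ) (X₀ : Set M) : Prop :=
  ∀ x ∈ X₀, ∀ y ∈ X₀, ∀ s t : TimeInterval T,
    F s.toNNReal x = F t.toNNReal y → s = t ∧ x = y

/-- `φ ∈ C(X)` is a Koopman eigenfunction with eigenvalue `lam` from the initial conditions `X₀`:
`φ(x) = exp(-lam t) φ(Fᵗ(x))` for all `x ∈ X₀` and `t ∈ [0, T]`. -/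
def IsKoopmanEigenfunction (F : Flow ℝ≥0 M) (T : ℝ) {X : Set M} (X₀ : Set M) (lam : ℂ)
    (φ : C(X, ℂ)) : Prop :=
  ∀ (x y : X) (t : TimeInterval T), (x : M) ∈ X₀ → (y : M) = F t.toNNReal x →
    φ x = Complex.exp (-lam * ((t : ℝ) : ℂ)) * φ y

end Dynamics

/-- A universal kernel on a (compact) space: a continuous, symmetric, positive semidefinite real
kernel whose sections span a uniformly dense subspace of the continuous functions. -/
structure IsUniversalKernel {X : Type*} [TopologicalSpace X] (k : X → X → ℝ) : Prop where
  continuous : Continuous (Function.uncurry k)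
  posSemidef : (Matrix.of k).PosSemidef
  dense : ∀ (g : C(X, ℝ)) (ε : ℝ), 0 < ε →
    ∃ h ∈ Submodule.span ℝ (Set.range fun x' : X => fun x : X => k x x'), ∀ x, |h x - g x| < ε

section Operators

variable {T : ℝ}

lemma continuous_integral_mul (c : C(TimeInterval T × TimeInterval T, ℂ)) (β : OutputSpace T) :
    Continuous fun t : TimeInterval T => ∫ t' : TimeInterval T, c (t, t') * β t' := by
  have hβ : Integrable (β : TimeInterval T → ℂ) :=
    (Lp.memLp β).integrable (by norm_num)
  refine continuous_of_dominated (bound := fun t' => ‖c‖ * ‖β t'‖) ?_ ?_ ?_ ?_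
  · intro t
    have h : Continuous fun t' : TimeInterval T => c (t, t') := by fun_prop
    exact h.aestronglyMeasurable.mul hβ.aestronglyMeasurable
  · intro t
    refine Filter.Eventually.of_forall fun t' => ?_
    rw [norm_mul]
    gcongr
    exact c.norm_coe_le_norm _
  · exact hβ.norm.const_mul _
  · refine Filter.Eventually.of_forall fun t' => ?_
    fun_prop

lemma integrable_mul (c : C(TimeInterval T × TimeInterval T, ℂ)) (β : OutputSpace T)
    (t : TimeInterval T) : Integrable fun t' : TimeInterval T => c (t, t') * β t' := by
  have hβ : Integrable (β : TimeInterval T → ℂ) :=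
    (Lp.memLp β).integrable (by norm_num)
  have h : Continuous fun t' : TimeInterval T => c (t, t') := by fun_prop
  refine Integrable.bdd_mul (c := ‖c‖) hβ h.aestronglyMeasurable ?_
  exact Filter.Eventually.of_forall fun t' => c.norm_coe_le_norm _

/-- The linear map `β ↦ (t ↦ ∫_0^T c(t, t') β(t') dt')` from `L²([0, T]; ℂ)` to `C([0, T]; ℂ)`, for
a continuous `c`. -/
noncomputable def integralMap (c : C(TimeInterval T × TimeInterval T, ℂ)) :
    OutputSpace T →ₗ[ℂ] C(TimeInterval T, ℂ) where
  toFun β := ⟨fun t => ∫ t' : TimeInterval T, c (t, t') * β t', continuous_integral_mul c β⟩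
  map_add' := by
    intro β₁ β₂
    ext t
    simp only [ContinuousMap.coe_mk, ContinuousMap.add_apply]
    rw [← integral_add (integrable_mul c β₁ t) (integrable_mul c β₂ t)]
    refine integral_congr_ae ?_
    filter_upwards [Lp.coeFn_add β₁ β₂] with t' ht'
    rw [ht', Pi.add_apply, mul_add]
  map_smul' := by
    intro a β
    ext t
    simp only [ContinuousMap.coe_mk, ContinuousMap.smul_apply, RingHom.id_apply]
    rw [← integral_smul]
    refine integral_congr_ae ?_
    filter_upwards [Lp.coeFn_smul a β] with t' ht'
    rw [ht', Pi.smul_apply, smul_eq_mul, smul_eq_mul]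
    ring

lemma norm_integralMap_le (c : C(TimeInterval T × TimeInterval T, ℂ)) (β : OutputSpace T) :
    ‖integralMap c β‖ ≤ ‖(ContinuousMap.toLp 2 (volume : Measure (TimeInterval T)) ℂ :
        C(TimeInterval T, ℂ) →L[ℂ] OutputSpace T)‖ * ‖c‖ * ‖β‖ := by
  refine (ContinuousMap.norm_le _ (by positivity)).2 fun t => ?_
  let g : C(TimeInterval T, ℂ) := ⟨fun t' => conj (c (t, t')), by fun_prop⟩
  have hg : ‖g‖ ≤ ‖c‖ := (ContinuousMap.norm_le _ (norm_nonneg _)).2 fun t' => by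
    simpa [g] using c.norm_coe_le_norm (t, t')
  have key : integralMap c β t =
      inner ℂ (ContinuousMap.toLp 2 (volume : Measure (TimeInterval T)) ℂ g) β := by
    rw [L2.inner_def]
    refine integral_congr_ae ?_
    filter_upwards [ContinuousMap.coeFn_toLp (p := 2) (𝕜 := ℂ)
      (volume : Measure (TimeInterval T)) g] with t' ht'
    rw [ht', RCLike.inner_apply]
    simp [g, mul_comm]
  rw [key]
  refine (norm_inner_le_norm _ _).trans ?_
  gcongr
  refine (ContinuousLinearMap.le_opNorm _ g).trans ?_
  gcongr

/-- The integral operator `(A β)(t) = ∫_0^T c(t, t') β(t') dt'` as a bounded operator on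
`L²([0, T]; ℂ)`, for a continuous `c`. -/
noncomputable def integralOperator (c : C(TimeInterval T × TimeInterval T, ℂ)) :
    OutputSpace T →L[ℂ] OutputSpace T :=
  (ContinuousMap.toLp 2 (volume : Measure (TimeInterval T)) ℂ).comp
    ((integralMap c).mkContinuous _ (norm_integralMap_le c))

variable {X : Type*} [TopologicalSpace X]

/-- The function
`(t, t') ↦ ∫_0^T ∫_0^T exp(-lam (τ - t)) k(γ(τ), γ'(τ')) exp(-conj lam (τ' - t')) dτ' dτ`. -/
noncomputable def eigenKernelFun (k : X → X → ℝ) (lam : ℂ) (γ γ' : C(TimeInterval T, X))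
    (t t' : TimeInterval T) : ℂ :=
  ∫ τ : TimeInterval T, ∫ τ' : TimeInterval T,
    Complex.exp (-lam * (((τ : ℝ) : ℂ) - ((t : ℝ) : ℂ))) * ((k (γ τ) (γ' τ') : ℝ) : ℂ) *
      Complex.exp (-conj lam * (((τ' : ℝ) : ℂ) - ((t' : ℝ) : ℂ)))

lemma eigenKernelFun_eq (k : X → X → ℝ) (lam : ℂ) (γ γ' : C(TimeInterval T, X))
    (t t' : TimeInterval T) :
    eigenKernelFun k lam γ γ' t t' =
      Complex.exp (lam * ((t : ℝ) : ℂ)) * Complex.exp (conj lam * ((t' : ℝ) : ℂ)) *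
        ∫ τ : TimeInterval T, ∫ τ' : TimeInterval T,
          Complex.exp (-lam * ((τ : ℝ) : ℂ)) * ((k (γ τ) (γ' τ') : ℝ) : ℂ) *
            Complex.exp (-conj lam * ((τ' : ℝ) : ℂ)) := by
  unfold eigenKernelFun
  simp only [← integral_const_mul]
  refine congrArg _ (funext fun τ => congrArg _ (funext fun τ' => ?_))
  rw [mul_sub, mul_sub, sub_eq_add_neg, sub_eq_add_neg, Complex.exp_add, Complex.exp_add]
  simp only [neg_mul, neg_neg]
  ring

lemma continuous_eigenKernelFun (k : X → X → ℝ) (lam : ℂ) (γ γ' : C(TimeInterval T, X)) :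
    Continuous fun p : TimeInterval T × TimeInterval T => eigenKernelFun k lam γ γ' p.1 p.2 := by
  simp only [eigenKernelFun_eq]
  refine Continuous.mul ?_ continuous_const
  fun_prop

/-- The Koopman eigenfunction kernel: for trajectories `γ, γ'` it is the bounded operator on
`L²([0, T]; ℂ)` given by
`(K(γ, γ') β)(t) =
  ∫ (∫∫ exp(-lam (τ - t)) k(γ(τ), γ'(τ')) exp(-conj lam (τ' - t')) dτ' dτ) β(t') dt'`. -/
noncomputable def eigenKernel (k : X → X → ℝ) (lam : ℂ) (XT : Set C(TimeInterval T, X)) :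
    Matrix XT XT (OutputSpace T →L[ℂ] OutputSpace T) :=
  Matrix.of fun γ γ' => integralOperator
    ⟨fun p => eigenKernelFun k lam γ.1 γ'.1 p.1 p.2, continuous_eigenKernelFun k lam γ.1 γ'.1⟩

end Operators

section Spaces

variable {T : ℝ} {X : Type*} [TopologicalSpace X] {XT : Set C(TimeInterval T, X)}
  (H : Type*) [NormedAddCommGroup H] [InnerProductSpace ℂ H] [CompleteSpace H]
  [RKHS ℂ H XT (OutputSpace T)]

/-- The span of all kernel sections `K(·, γ) β`. -/
noncomputable def sectionSpan : Submodule ℂ H :=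
  Submodule.span ℂ {h | ∃ (γ : XT) (β : OutputSpace T), h = RKHS.kerFun H γ β}

/-- The span of the kernel sections at the data: all sums `∑ i, K(·, x i) β i` with operator
coefficients `β i` in the output space. -/
noncomputable def dataSpan {N : ℕ} (x : Fin N → XT) : Submodule ℂ H :=
  Submodule.span ℂ {h | ∃ (i : Fin N) (β : OutputSpace T), h = RKHS.kerFun H (x i) β}

end Spaces

/-- An output trajectory has linear time-invariant dynamics with exponent `lam`:
`z(t) = exp(lam t) z(0)` for all `t ∈ [0, T]`, for some continuous representative `z`. -/
def HasLTIDynamics {T : ℝ} (lam : ℂ) (y : OutputSpace T) : Prop :=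
  ∃ z : C(TimeInterval T, ℂ), y =ᵐ[volume] z ∧
    ∀ t t₀ : TimeInterval T, (t₀ : ℝ) = 0 → z t = Complex.exp (lam * ((t : ℝ) : ℂ)) * z t₀

end KoopmanKernel

/-!
The kernel `eigenKernel` has rank one in the output space. Let `Φ` be a feature map of `k` into a
complex Hilbert space `G`, so that `⟪Φ x, Φ y⟫ = k x y`. It exists because the complexification of
`k` is again positive semidefinite, and it is continuous because `k` is
(`RKHS.exists_continuous_feature_map`). With `e(t) = exp(lam t)` and the Bochner integral
`A γ = ∫ exp(-conj lam τ) Φ(γ(τ)) dτ` in `G`, one has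
`K(γ, γ') β = (⟪A γ, A γ'⟫ ⟪e, β⟫) e`, that is `K(γ, γ') = (B γ)† B γ'` for the rank-one operators
`B γ = ⟪e, ·⟫ A γ` (`KoopmanKernel.eigenKernel_eq`). The three parts follow from this factorization.

* Kernels of the form `(B γ)† B γ'` are positive semidefinite, so Moore's theorem gives the space.
  Two spaces with the same kernel are isometric, since the correspondence of kernel functions
  preserves inner products and kernel functions are total
  (`RKHS.exists_linearIsometryEquiv_of_kernel_eq`).
* An eigenfunction satisfies `φ(γ(t)) = exp(lam t) φ(γ(0))`, and its pull-back
  `exp(-lam τ) φ(γ(τ))` is the constant `φ(γ(0))`. If `v` in `G` is such that `⟪Φ ·, v⟫` is uniformly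
  close to `φ`, which exists because `k` is universal, then `⟪A γ, v⟫` is uniformly close to
  `T φ(γ(0))`. Kernel sections produce exactly the coefficients `⟪A γ, w⟫` with `w` in the span of
  the vectors `A γ'`, and projecting `v` onto the closure of this span does not change `⟪A γ, v⟫`
  (`KoopmanKernel.exists_mem_span_norm_inner_sub_lt`). Hence no compactness of the set of
  trajectories is needed, only that the vectors `A γ` are bounded.
* Every combination of sections takes values in the line spanned by `e`. Under non-recurrence the
  values over the data descend to a continuous function on the compact union of the data
  trajectories, and the Tietze extension theorem extends it to `X`
  (`KoopmanKernel.exists_isKoopmanEigenfunction`).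
-/

namespace RKHS

open ContinuousLinearMap InnerProductSpace

/-! ### Reproducing kernel Hilbert spaces and feature maps -/

section General

variable {𝕜 X V H H' G : Type*} [RCLike 𝕜]
  [NormedAddCommGroup V] [InnerProductSpace 𝕜 V] [CompleteSpace V]
  [NormedAddCommGroup H] [InnerProductSpace 𝕜 H] [CompleteSpace H] [RKHS 𝕜 H X V]
  [NormedAddCommGroup H'] [InnerProductSpace 𝕜 H'] [CompleteSpace H'] [RKHS 𝕜 H' X V]
  [NormedAddCommGroup G] [InnerProductSpace 𝕜 G] [CompleteSpace G]

/-- A kernel that factors through a feature map `B`, as `K x y = (B x)† B y`, is positive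
semidefinite. -/
lemma posSemidef_of_features {K : Matrix X X (V →L[𝕜] V)} (B : X → V →L[𝕜] G)
    (hK : ∀ x y, K x y = (B x).adjoint ∘L B y) : K.PosSemidef := by
  have htfae := (posSemidef_tfae (K := K)).out 0 2
  refine htfae.2 ⟨?_, fun w => ?_⟩
  · ext1 x y
    simp only [Matrix.conjTranspose_apply, hK, star_eq_adjoint, adjoint_comp, adjoint_adjoint]
  · have : (w.sum fun x w₁ => w.sum fun x' w₂ => ⟪K x' x w₁, w₂⟫_𝕜) =
        ⟪w.sum fun x w₁ => B x w₁, w.sum fun x w₁ => B x w₁⟫_𝕜 := by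
      rw [Finsupp.sum_inner]
      refine Finsupp.sum_congr fun x _ => ?_
      rw [Finsupp.inner_sum]
      refine Finsupp.sum_congr fun x' _ => ?_
      rw [hK, comp_apply, adjoint_inner_left]
    rw [this]
    exact inner_self_nonneg

variable (H) in
lemma denseRange_linearCombination_kerFun :
    DenseRange (Finsupp.linearCombination 𝕜 fun p : X × V => kerFun H p.1 p.2) := by
  have h := kerFun_dense (𝕜 := 𝕜) (X := X) (V := V) (H := H)
  rw [← Submodule.dense_iff_topologicalClosure_eq_top] at h
  have hset : {x | ∃ (y : X) (w : V), kerFun H y w = x} =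
      Set.range fun p : X × V => kerFun H p.1 p.2 := by
    ext; simp
  rw [hset, ← Finsupp.range_linearCombination] at h
  simpa only [DenseRange, LinearMap.coe_range] using h

/-- A reproducing kernel Hilbert space is determined by its kernel: the correspondence of the kernel
functions is isometric, and the kernel functions are total. -/
theorem exists_linearIsometryEquiv_of_kernel_eq
    (h : kernel H' = (kernel H : Matrix X X (V →L[𝕜] V))) :
    ∃ Φ : H ≃ₗᵢ[𝕜] H', ∀ (f : H) (x : X), Φ f x = f x := by
  let L := Finsupp.linearCombination 𝕜 fun p : X × V => kerFun H p.1 p.2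
  let L' := Finsupp.linearCombination 𝕜 fun p : X × V => kerFun H' p.1 p.2
  have hinner : ∀ f, ⟪L' f, L' f⟫_𝕜 = ⟪L f, L f⟫_𝕜 := by
    intro f
    simp only [L, L', Finsupp.linearCombination_apply, Finsupp.sum_inner, Finsupp.inner_sum,
      inner_smul_left, inner_smul_right, ← kernel_inner, h]
  have hnorm : ∀ f, ‖L' (LinearEquiv.refl 𝕜 _ f)‖ = ‖L f‖ := by
    intro f
    rw [LinearEquiv.refl_apply, norm_eq_sqrt_re_inner (𝕜 := 𝕜), hinner,
      ← norm_eq_sqrt_re_inner (𝕜 := 𝕜)]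
  let Φ := (LinearEquiv.refl 𝕜 (X × V →₀ 𝕜)).extendOfIsometry L L'
    (denseRange_linearCombination_kerFun H) (denseRange_linearCombination_kerFun H') hnorm
  have hΦ : ∀ (x : X) (w : V), Φ (kerFun H x w) = kerFun H' x w := by
    intro x w
    have := (LinearEquiv.refl 𝕜 (X × V →₀ 𝕜)).extendOfIsometry_eq L L'
      (denseRange_linearCombination_kerFun H) (denseRange_linearCombination_kerFun H') hnorm
      (Finsupp.single (x, w) 1)
    simpa [L, L'] using this
  refine ⟨Φ, fun f x => ext_inner_left 𝕜 fun w => ?_⟩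
  rw [← kerFun_inner, ← hΦ, LinearIsometryEquiv.inner_map_map, kerFun_inner]

end General

/-- A continuous positive semidefinite real kernel is the Gram matrix of a continuous feature map
into a complex Hilbert space. -/
theorem exists_continuous_feature_map {X : Type u} [TopologicalSpace X] {k : X → X → ℝ}
    (hc : Continuous (Function.uncurry k)) (hk : (Matrix.of k).PosSemidef) :
    ∃ (G : Type u) (_ : NormedAddCommGroup G) (_ : InnerProductSpace ℂ G) (_ : CompleteSpace G)
      (Φ : X → G), Continuous Φ ∧ ∀ x y, ⟪Φ x, Φ y⟫_ℂ = k x y := by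
  let K : Matrix X X (ℂ →L[ℂ] ℂ) := .of fun x y => (k x y : ℂ) • ContinuousLinearMap.id ℂ ℂ
  have hsymm : ∀ x y, k y x = k x y := fun x y => by
    simpa using congrFun (congrFun hk.isHermitian x) y
  have hK : K.PosSemidef := by
    have htfae := (posSemidef_tfae (K := K)).out 0 2
    refine htfae.2 ⟨?_, fun w => ?_⟩
    · ext x y : 2
      have hid : (ContinuousLinearMap.id ℂ ℂ).adjoint = ContinuousLinearMap.id ℂ ℂ := star_one _
      simp [K, hsymm x y, star_eq_adjoint, hid]
    · -- the real and the imaginary parts of the coefficients contribute separately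
      have hre := hk.2 (w.mapRange Complex.re rfl)
      have him := hk.2 (w.mapRange Complex.im rfl)
      have hsum := add_nonneg hre him
      simp [Finsupp.sum_mapRange_index] at hsum
      rw [← Finsupp.sum_add] at hsum
      simp only [← Finsupp.sum_add] at hsum
      refine hsum.trans_eq ?_
      simp only [Finsupp.sum, map_sum]
      refine Finset.sum_congr rfl fun x _ => Finset.sum_congr rfl fun y _ => ?_
      simp [K, hsymm x y]
      ring
  have : Fact K.PosSemidef := ⟨hK⟩
  have hinner : ∀ x y, ⟪kerFun (OfKernel K) x 1, kerFun (OfKernel K) y 1⟫_ℂ = (k x y : ℂ) := by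
    intro x y
    rw [← kernel_inner, OfKernel.kernel_ofKernel]
    simp [K, hsymm x y]
  refine ⟨OfKernel K, inferInstance, inferInstance, inferInstance,
    fun x => kerFun (OfKernel K) x 1, ?_, hinner⟩
  have hsq : ∀ x y, ‖kerFun (OfKernel K) x 1 - kerFun (OfKernel K) y 1‖ =
      √(k x x - 2 * k x y + k y y) := by
    intro x y
    rw [← Real.sqrt_sq (norm_nonneg (_ - _)), norm_sub_sq (𝕜 := ℂ), hinner,
      ← inner_self_eq_norm_sq (𝕜 := ℂ), ← inner_self_eq_norm_sq (𝕜 := ℂ), hinner, hinner]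
    rfl
  refine continuous_iff_continuousAt.2 fun x₀ => tendsto_iff_norm_sub_tendsto_zero.2 ?_
  simp only [hsq]
  have hcont : Continuous fun x => √(k x x - 2 * k x x₀ + k x₀ x₀) := by
    have h₁ : Continuous fun x => k x x := hc.comp (continuous_id.prodMk continuous_id)
    have h₂ : Continuous fun x => k x x₀ := hc.comp (continuous_id.prodMk continuous_const)
    fun_prop
  have hzero : √(k x₀ x₀ - 2 * k x₀ x₀ + k x₀ x₀) = 0 := by
    rw [show k x₀ x₀ - 2 * k x₀ x₀ + k x₀ x₀ = 0 by ring, Real.sqrt_zero]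
  simpa only [hzero] using hcont.tendsto x₀

end RKHS

namespace KoopmanKernel

open ContinuousLinearMap InnerProductSpace

/-! ### Exponential outputs and averages along trajectories -/

section

variable {T : ℝ} {G : Type*} [NormedAddCommGroup G] [InnerProductSpace ℂ G]

/-- The output trajectory `t ↦ exp(lam t)`. -/
noncomputable def expOutput (T : ℝ) (lam : ℂ) : OutputSpace T :=
  ContinuousMap.toLp 2 volume ℂ ⟨fun t : TimeInterval T => Complex.exp (lam * ((t : ℝ) : ℂ)),
    by fun_prop⟩

lemma coeFn_expOutput (T : ℝ) (lam : ℂ) :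
    expOutput T lam =ᵐ[volume] fun t : TimeInterval T => Complex.exp (lam * ((t : ℝ) : ℂ)) :=
  ContinuousMap.coeFn_toLp _ _

lemma coeFn_smul_expOutput (lam c : ℂ) :
    (c • expOutput T lam : OutputSpace T) =ᵐ[volume]
      fun t : TimeInterval T => c * Complex.exp (lam * ((t : ℝ) : ℂ)) := by
  filter_upwards [Lp.coeFn_smul c (expOutput T lam), coeFn_expOutput T lam] with t h₁ h₂
  rw [h₁, Pi.smul_apply, h₂, smul_eq_mul]

lemma inner_expOutput (lam : ℂ) (β : OutputSpace T) :
    ⟪expOutput T lam, β⟫_ℂ =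
      ∫ t : TimeInterval T, Complex.exp (conj lam * ((t : ℝ) : ℂ)) * β t := by
  rw [L2.inner_def]
  refine integral_congr_ae ?_
  filter_upwards [coeFn_expOutput T lam] with t ht
  rw [ht, RCLike.inner_apply, ← Complex.exp_conj, map_mul, Complex.conj_ofReal, mul_comm]

lemma volume_real_timeInterval (hT : 0 ≤ T) :
    (volume : Measure (TimeInterval T)).real Set.univ = T := by
  rw [Measure.real, Measure.Subtype.volume_univ measurableSet_Icc.nullMeasurableSet,
    Real.volume_Icc, sub_zero, ENNReal.toReal_ofReal hT]

lemma expOutput_ne_zero (hT : 0 < T) (lam : ℂ) : expOutput T lam ≠ 0 := by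
  intro h
  have h₀ : ∀ᵐ _ : TimeInterval T, False := by
    filter_upwards [coeFn_expOutput T lam, Lp.coeFn_zero ℂ 2 (volume : Measure (TimeInterval T))]
      with t h₁ h₂
    rw [h, h₂] at h₁
    exact Complex.exp_ne_zero _ h₁.symm
  have h₁ := volume_real_timeInterval hT.le
  rw [ae_iff] at h₀
  simp only [not_false_eq_true, Set.ofPred_true] at h₀
  rw [Measure.real, h₀, ENNReal.toReal_zero] at h₁
  exact hT.ne h₁

/-- The vector `∫_0^T exp(-conj lam τ) f(τ) dτ`. Pairing with it averages the pull-backs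
`exp(-lam τ) ⟪f(τ), v⟫` of an observable along a trajectory. -/
noncomputable def expAverage (lam : ℂ) (f : TimeInterval T → G) : G :=
  ∫ τ : TimeInterval T, Complex.exp (-conj lam * ((τ : ℝ) : ℂ)) • f τ

lemma norm_exp_mul_le {T : ℝ} (lam : ℂ) (t : TimeInterval T) :
    ‖Complex.exp (lam * ((t : ℝ) : ℂ))‖ ≤ Real.exp (‖lam‖ * T) := by
  refine (Complex.norm_exp_le_exp_norm _).trans (Real.exp_le_exp.2 ?_)
  rw [norm_mul, Complex.norm_real, Real.norm_of_nonneg t.2.1]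
  exact mul_le_mul_of_nonneg_left t.2.2 (norm_nonneg _)

lemma norm_expAverage_le (hT : 0 ≤ T) (lam : ℂ) {f : TimeInterval T → G} {C : ℝ}
    (hf : ∀ τ, ‖f τ‖ ≤ C) :
    ‖expAverage lam f‖ ≤ Real.exp (‖lam‖ * T) * C * T := by
  have hb : ∀ τ : TimeInterval T, ‖Complex.exp (-conj lam * ((τ : ℝ) : ℂ)) • f τ‖ ≤
      Real.exp (‖lam‖ * T) * C := by
    intro τ
    rw [norm_smul]
    have := norm_exp_mul_le (-conj lam) τ
    rw [norm_neg, RCLike.norm_conj] at this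
    gcongr
    exact hf τ
  refine (norm_integral_le_of_norm_le_const (Filter.Eventually.of_forall hb)).trans_eq ?_
  rw [volume_real_timeInterval hT]

variable [CompleteSpace G]

lemma inner_expAverage_right (lam : ℂ) {f : TimeInterval T → G} (hf : Continuous f) (v : G) :
    ⟪v, expAverage lam f⟫_ℂ =
      ∫ τ : TimeInterval T, ⟪v, f τ⟫_ℂ * Complex.exp (-conj lam * ((τ : ℝ) : ℂ)) := by
  have hint : Integrable fun τ : TimeInterval T =>
      Complex.exp (-conj lam * ((τ : ℝ) : ℂ)) • f τ :=
    (by fun_prop : Continuous _).integrable_of_hasCompactSupport (HasCompactSupport.of_compactSpace _)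
  rw [expAverage, ← integral_inner hint]
  refine integral_congr_ae (Filter.Eventually.of_forall fun τ => ?_)
  simp only [inner_smul_right, mul_comm]

lemma inner_expAverage_left (lam : ℂ) {f : TimeInterval T → G} (hf : Continuous f) (v : G) :
    ⟪expAverage lam f, v⟫_ℂ =
      ∫ τ : TimeInterval T, Complex.exp (-lam * ((τ : ℝ) : ℂ)) * ⟪f τ, v⟫_ℂ := by
  rw [← inner_conj_symm, inner_expAverage_right lam hf, ← integral_conj]
  refine integral_congr_ae (Filter.Eventually.of_forall fun τ => ?_)
  simp only [map_mul, inner_conj_symm, ← Complex.exp_conj, map_neg, Complex.conj_conj,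
    Complex.conj_ofReal, mul_comm]

/-! ### The rank-one factorization of the kernel and its sections -/

variable {X : Type*} [TopologicalSpace X] {k : X → X → ℝ} {Φ : X → G}

/-- The Koopman eigenfunction kernel has the rank-one features
`β ↦ ⟪exp(lam ·), β⟫ ∫_0^T exp(-conj lam τ) Φ(γ(τ)) dτ`, where `Φ` is a feature map of `k`. -/
theorem eigenKernel_eq (hΦ : Continuous Φ) (hk : ∀ x y, ⟪Φ x, Φ y⟫_ℂ = k x y) (lam : ℂ)
    (XT : Set C(TimeInterval T, X)) (γ γ' : XT) :
    eigenKernel k lam XT γ γ' =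
      (rankOne ℂ (expAverage lam (Φ ∘ γ.1)) (expOutput T lam)).adjoint ∘L
        rankOne ℂ (expAverage lam (Φ ∘ γ'.1)) (expOutput T lam) := by
  have ha : ⟪expAverage lam (Φ ∘ γ.1), expAverage lam (Φ ∘ γ'.1)⟫_ℂ =
      ∫ τ : TimeInterval T, ∫ τ' : TimeInterval T,
          Complex.exp (-lam * ((τ : ℝ) : ℂ)) * ((k (γ.1 τ) (γ'.1 τ') : ℝ) : ℂ) *
            Complex.exp (-conj lam * ((τ' : ℝ) : ℂ)) := by
    rw [inner_expAverage_left lam (by fun_prop)]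
    refine integral_congr_ae (Filter.Eventually.of_forall fun τ => ?_)
    simp only [inner_expAverage_right lam (hΦ.comp γ'.1.continuous), ← integral_const_mul,
      Function.comp_apply, hk, mul_assoc]
  ext1 β
  rw [comp_apply, rankOne_apply, map_smul, adjoint_rankOne, rankOne_apply, ha, smul_smul]
  refine Lp.ext ?_
  refine (ContinuousMap.coeFn_toLp (p := 2) (𝕜 := ℂ) (volume : Measure (TimeInterval T))
    (integralMap _ β)).trans (Filter.EventuallyEq.symm ?_)
  filter_upwards [coeFn_smul_expOutput lam _] with t ht
  rw [ht]
  simp only [integralMap, LinearMap.coe_mk, AddHom.coe_mk, ContinuousMap.coe_mk, eigenKernelFun_eq,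
    inner_expOutput]
  rw [← integral_mul_const, ← integral_mul_const]
  refine integral_congr_ae (Filter.Eventually.of_forall fun t' => ?_)
  simp only
  ring

end

lemma hasLTIDynamics_smul_expOutput {T : ℝ} (lam c : ℂ) :
    HasLTIDynamics lam (c • expOutput T lam) := by
  refine ⟨⟨fun t => c * Complex.exp (lam * ((t : ℝ) : ℂ)), by fun_prop⟩,
    coeFn_smul_expOutput lam c, fun t t₀ ht₀ => ?_⟩
  simp [ht₀, mul_comm]

section

variable {T : ℝ} {G : Type*} [NormedAddCommGroup G] [InnerProductSpace ℂ G] [CompleteSpace G]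
  {X : Type*} [TopologicalSpace X] {XT : Set C(TimeInterval T, X)}
  {H : Type*} [NormedAddCommGroup H] [InnerProductSpace ℂ H] [CompleteSpace H]
  [RKHS ℂ H XT (OutputSpace T)] {lam : ℂ} {A : XT → G}

lemma kerFun_apply_eq_smul
    (hK : ∀ γ γ', RKHS.kernel H γ γ' = (rankOne ℂ (A γ) (expOutput T lam)).adjoint ∘L
      rankOne ℂ (A γ') (expOutput T lam)) (γ γ' : XT) (β : OutputSpace T) :
    RKHS.kerFun H γ' β γ =
      (⟪expOutput T lam, β⟫_ℂ * ⟪A γ, A γ'⟫_ℂ) • expOutput T lam := by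
  rw [RKHS.kerFun_apply, hK, comp_apply, rankOne_apply, map_smul, adjoint_rankOne, rankOne_apply,
    smul_smul]

lemma exists_eq_smul_expOutput_of_mem_dataSpan
    (hK : ∀ γ γ', RKHS.kernel H γ γ' = (rankOne ℂ (A γ) (expOutput T lam)).adjoint ∘L
      rankOne ℂ (A γ') (expOutput T lam)) {N : ℕ} {x : Fin N → XT} {h : H}
    (hh : h ∈ dataSpan H x) (γ : XT) : ∃ c : ℂ, h γ = c • expOutput T lam := by
  induction hh using Submodule.span_induction with
  | mem h hh =>
    obtain ⟨i, β, rfl⟩ := hh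
    exact ⟨_, kerFun_apply_eq_smul hK γ (x i) β⟩
  | zero => exact ⟨0, by simp⟩
  | add f g _ _ hf hg =>
    obtain ⟨a, ha⟩ := hf
    obtain ⟨b, hb⟩ := hg
    exact ⟨a + b, by rw [RKHS.coe_add, Pi.add_apply, ha, hb, add_smul]⟩
  | smul a f _ hf =>
    obtain ⟨b, hb⟩ := hf
    exact ⟨a * b, by rw [RKHS.coe_smul, Pi.smul_apply, hb, mul_smul]⟩

/-- Every functional `γ ↦ ⟪A γ, w⟫` with `w` in the span of the features is attained as the
coefficient of `exp(lam ·)` in a combination of kernel sections. -/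
lemma exists_mem_sectionSpan (hT : 0 < T)
    (hK : ∀ γ γ', RKHS.kernel H γ γ' = (rankOne ℂ (A γ) (expOutput T lam)).adjoint ∘L
      rankOne ℂ (A γ') (expOutput T lam)) {w : G} (hw : w ∈ Submodule.span ℂ (Set.range A)) :
    ∃ h ∈ sectionSpan H, ∀ γ : XT, h γ = ⟪A γ, w⟫_ℂ • expOutput T lam := by
  induction hw using Submodule.span_induction with
  | mem w hw =>
    obtain ⟨γ', rfl⟩ := hw
    have he : ⟪expOutput T lam, expOutput T lam⟫_ℂ ≠ 0 :=
      inner_self_ne_zero.2 (expOutput_ne_zero hT lam)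
    refine ⟨RKHS.kerFun H γ' ((⟪expOutput T lam, expOutput T lam⟫_ℂ)⁻¹ • expOutput T lam),
      Submodule.subset_span ⟨γ', _, rfl⟩, fun γ => ?_⟩
    rw [kerFun_apply_eq_smul hK, inner_smul_right, inv_mul_cancel₀ he, one_mul]
  | zero => exact ⟨0, Submodule.zero_mem _, by simp⟩
  | add v w _ _ hv hw =>
    obtain ⟨f, hf, hfv⟩ := hv
    obtain ⟨g, hg, hgw⟩ := hw
    refine ⟨f + g, Submodule.add_mem _ hf hg, fun γ => ?_⟩
    rw [RKHS.coe_add, Pi.add_apply, hfv, hgw, inner_add_right, add_smul]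
  | smul a v _ hv =>
    obtain ⟨f, hf, hfv⟩ := hv
    refine ⟨a • f, Submodule.smul_mem _ a hf, fun γ => ?_⟩
    rw [RKHS.coe_smul, Pi.smul_apply, hfv, inner_smul_right, mul_smul]

end

/-! ### Approximation by features -/

/-- On a bounded family of vectors, any vector acts, up to a uniformly small error, like a linear
combination of the family: the projection onto the closed span acts in the same way. -/
lemma exists_mem_span_norm_inner_sub_lt {ι G : Type*} [NormedAddCommGroup G]
    [InnerProductSpace ℂ G] [CompleteSpace G] {A : ι → G} {C : ℝ} (hC : 0 < C)
    (hA : ∀ i, ‖A i‖ ≤ C) (v : G) {δ : ℝ} (hδ : 0 < δ) :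
    ∃ w ∈ Submodule.span ℂ (Set.range A), ∀ i, ‖⟪A i, w⟫_ℂ - ⟪A i, v⟫_ℂ‖ < δ := by
  let P := (Submodule.span ℂ (Set.range A)).topologicalClosure
  have : CompleteSpace P := (Submodule.isClosed_topologicalClosure _).completeSpace_coe
  have hp : P.starProjection v ∈ closure (Submodule.span ℂ (Set.range A) : Set G) :=
    Submodule.starProjection_apply_mem P v
  obtain ⟨w, hw, hdist⟩ := Metric.mem_closure_iff.1 hp (δ / C) (by positivity)
  refine ⟨w, hw, fun i => ?_⟩
  have hAi : A i ∈ P := Submodule.le_topologicalClosure _ (Submodule.subset_span ⟨i, rfl⟩)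
  have hproj : ⟪A i, P.starProjection v⟫_ℂ = ⟪A i, v⟫_ℂ := by
    rw [← Submodule.inner_starProjection_left_eq_right,
      Submodule.starProjection_eq_self_iff.2 hAi]
  rw [← hproj, ← inner_sub_right]
  refine (norm_inner_le_norm _ _).trans_lt ?_
  rw [dist_comm, dist_eq_norm] at hdist
  calc ‖A i‖ * ‖w - P.starProjection v‖ ≤ C * ‖w - P.starProjection v‖ := by gcongr; exact hA i
    _ < C * (δ / C) := by gcongr
    _ = δ := by field_simp

section

variable {X G : Type*} [NormedAddCommGroup G] [InnerProductSpace ℂ G]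
  {k : X → X → ℝ} {Φ : X → G}

lemma exists_inner_eq_of_mem_span (hk : ∀ x y, ⟪Φ x, Φ y⟫_ℂ = k x y) {g : X → ℝ}
    (hg : g ∈ Submodule.span ℝ (Set.range fun x' : X => fun x : X => k x x')) :
    ∃ v : G, ∀ x, ⟪Φ x, v⟫_ℂ = g x := by
  induction hg using Submodule.span_induction with
  | mem g hg =>
    obtain ⟨y, rfl⟩ := hg
    exact ⟨Φ y, fun x => hk x y⟩
  | zero => exact ⟨0, by simp⟩
  | add f g _ _ hf hg =>
    obtain ⟨v, hv⟩ := hf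
    obtain ⟨w, hw⟩ := hg
    exact ⟨v + w, fun x => by simp [hv, hw]⟩
  | smul a f _ hf =>
    obtain ⟨v, hv⟩ := hf
    exact ⟨(a : ℂ) • v, fun x => by simp [hv]⟩

/-- For a universal kernel the functions `x ↦ ⟪Φ x, v⟫` are uniformly dense in the continuous
complex functions. -/
lemma IsUniversalKernel.exists_norm_inner_sub_lt [TopologicalSpace X] (hu : IsUniversalKernel k)
    (hk : ∀ x y, ⟪Φ x, Φ y⟫_ℂ = k x y) (φ : C(X, ℂ)) {δ : ℝ} (hδ : 0 < δ) :
    ∃ v : G, ∀ x, ‖⟪Φ x, v⟫_ℂ - φ x‖ < δ := by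
  obtain ⟨g, hg, hgφ⟩ := hu.dense ⟨fun x => (φ x).re, by fun_prop⟩ (δ / 2) (by positivity)
  obtain ⟨g', hg', hgφ'⟩ := hu.dense ⟨fun x => (φ x).im, by fun_prop⟩ (δ / 2) (by positivity)
  obtain ⟨v, hv⟩ := exists_inner_eq_of_mem_span hk hg
  obtain ⟨v', hv'⟩ := exists_inner_eq_of_mem_span hk hg'
  refine ⟨v + Complex.I • v', fun x => ?_⟩
  refine (Complex.norm_le_abs_re_add_abs_im _).trans_lt ?_
  have h₁ := hgφ x
  have h₂ := hgφ' x
  simp only [ContinuousMap.coe_mk] at h₁ h₂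
  have hre : (⟪Φ x, v + Complex.I • v'⟫_ℂ - φ x).re = g x - (φ x).re := by
    simp [hv, hv']
  have him : (⟪Φ x, v + Complex.I • v'⟫_ℂ - φ x).im = g' x - (φ x).im := by
    simp [hv, hv']
  rw [hre, him]
  linarith

end

/-! ### Koopman eigenfunctions -/

section

variable {M : Type*} [TopologicalSpace M] {F : Flow ℝ≥0 M} {T : ℝ} {X X₀ : Set M} {lam : ℂ}

lemma apply_eq_of_coe_eq_zero {x₀ : M} {γ : C(TimeInterval T, X)}
    (hγ : ∀ t, (γ t : M) = F t.toNNReal x₀) {t₀ : TimeInterval T} (ht₀ : (t₀ : ℝ) = 0) :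
    (γ t₀ : M) = x₀ := by
  have : t₀.toNNReal = 0 := NNReal.coe_injective ht₀
  rw [hγ, this, F.map_zero_apply]

lemma IsKoopmanEigenfunction.apply_zero_eq {φ : C(X, ℂ)}
    (hφ : IsKoopmanEigenfunction F T X₀ lam φ) {γ : C(TimeInterval T, X)}
    (hγ : γ ∈ trajectorySpace F T X X₀) {t₀ : TimeInterval T} (ht₀ : (t₀ : ℝ) = 0)
    (t : TimeInterval T) : φ (γ t₀) = Complex.exp (-lam * ((t : ℝ) : ℂ)) * φ (γ t) := by
  obtain ⟨x₀, hx₀, hγ⟩ := hγ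
  have h₀ := apply_eq_of_coe_eq_zero hγ ht₀
  exact hφ (γ t₀) (γ t) t (h₀.symm ▸ hx₀) (by rw [hγ, h₀])

/-- Averaging the pull-backs of a function that is uniformly close to a Koopman eigenfunction
recovers `T` times the value of the eigenfunction at the initial condition. -/
lemma norm_inner_expAverage_sub_le {G : Type*} [NormedAddCommGroup G] [InnerProductSpace ℂ G]
    [CompleteSpace G] {Φ : X → G} (hΦ : Continuous Φ) (hT : 0 ≤ T) {φ : C(X, ℂ)}
    (hφ : IsKoopmanEigenfunction F T X₀ lam φ) {v : G} {δ : ℝ}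
    (hv : ∀ x, ‖⟪Φ x, v⟫_ℂ - φ x‖ < δ) {γ : C(TimeInterval T, X)}
    (hγ : γ ∈ trajectorySpace F T X X₀) {t₀ : TimeInterval T} (ht₀ : (t₀ : ℝ) = 0) :
    ‖⟪expAverage lam (Φ ∘ γ), v⟫_ℂ - T * φ (γ t₀)‖ ≤ Real.exp (‖lam‖ * T) * δ * T := by
  have hconst : (T : ℂ) * φ (γ t₀) =
      ∫ τ : TimeInterval T, Complex.exp (-lam * ((τ : ℝ) : ℂ)) * φ (γ τ) := by
    simp only [← hφ.apply_zero_eq hγ ht₀]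
    rw [integral_const, volume_real_timeInterval hT, Complex.real_smul]
  rw [inner_expAverage_left lam (hΦ.comp γ.continuous), hconst, ← integral_sub]
  · refine (norm_integral_le_of_norm_le_const (C := Real.exp (‖lam‖ * T) * δ)
      (Filter.Eventually.of_forall fun τ => ?_)).trans_eq (by rw [volume_real_timeInterval hT])
    rw [← mul_sub, norm_mul]
    have := norm_exp_mul_le (-lam) τ
    rw [norm_neg] at this
    gcongr
    exact (hv _).le
  · exact (by fun_prop : Continuous _).integrable_of_hasCompactSupport
      (HasCompactSupport.of_compactSpace _)
  · exact (by fun_prop : Continuous _).integrable_of_hasCompactSupport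
      (HasCompactSupport.of_compactSpace _)

/-- Universality: the coefficient `φ(γ(0))` of a Koopman eigenfunction along `γ` is an average
along the trajectory, which the kernel sections approximate uniformly over all trajectories. -/
theorem exists_mem_sectionSpan_norm_sub_lt [CompactSpace X] (hT : 0 < T) {k : X → X → ℝ}
    (hu : IsUniversalKernel k) {G : Type*} [NormedAddCommGroup G] [InnerProductSpace ℂ G]
    [CompleteSpace G] {Φ : X → G} (hΦ : Continuous Φ) (hk : ∀ x y, ⟪Φ x, Φ y⟫_ℂ = k x y)
    {H : Type*} [NormedAddCommGroup H] [InnerProductSpace ℂ H] [CompleteSpace H]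
    [RKHS ℂ H (trajectorySpace F T X X₀) (OutputSpace T)]
    (hK : RKHS.kernel H = eigenKernel k lam (trajectorySpace F T X X₀)) {φ : C(X, ℂ)}
    (hφ : IsKoopmanEigenfunction F T X₀ lam φ) {ε : ℝ} (hε : 0 < ε) :
    ∃ h ∈ sectionSpan H, ∀ γ : trajectorySpace F T X X₀,
      ∀ᵐ t : TimeInterval T, ‖h γ t - φ (γ.1 t)‖ < ε := by
  set E := Real.exp (‖lam‖ * T) with hE
  have hEpos : 0 < E := Real.exp_pos _
  let A : trajectorySpace F T X X₀ → G := fun γ => expAverage lam (Φ ∘ γ.1)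
  let t₀ : TimeInterval T := ⟨0, le_rfl, hT.le⟩
  -- The average multiplies the error of `v` by at most `E * T`, and passing from the coefficient to
  -- the output multiplies the total error by at most `E / T`.
  obtain ⟨v, hv⟩ := hu.exists_norm_inner_sub_lt hk φ (δ := ε / (2 * E * E)) (by positivity)
  obtain ⟨R, hR⟩ : ∃ R, ∀ x, ‖Φ x‖ ≤ R := by
    obtain ⟨R, hR⟩ := (isCompact_range hΦ).isBounded.exists_norm_le
    exact ⟨R, fun x => hR _ ⟨x, rfl⟩⟩
  have hA : ∀ γ, ‖A γ‖ ≤ E * max R 1 * T := fun γ =>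
    norm_expAverage_le hT.le lam fun τ => (hR _).trans (le_max_left _ _)
  obtain ⟨w, hw, hwv⟩ := exists_mem_span_norm_inner_sub_lt (C := E * max R 1 * T)
    (by positivity) hA v (δ := T * ε / (2 * E)) (by positivity)
  obtain ⟨h, hh, hval⟩ := exists_mem_sectionSpan (H := H) (lam := lam) hT
    (fun γ γ' => by rw [hK, eigenKernel_eq hΦ hk])
    (Submodule.smul_mem _ ((T : ℂ)⁻¹) hw)
  refine ⟨h, hh, fun γ => ?_⟩
  rw [hval]
  filter_upwards [coeFn_smul_expOutput lam ⟪A γ, (T : ℂ)⁻¹ • w⟫_ℂ] with t ht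
  have hTC : (T : ℂ) ≠ 0 := by exact_mod_cast hT.ne'
  have hflow : φ (γ.1 t) = φ (γ.1 t₀) * Complex.exp (lam * ((t : ℝ) : ℂ)) := by
    rw [hφ.apply_zero_eq γ.2 (rfl : (t₀ : ℝ) = 0) t, mul_right_comm, ← Complex.exp_add, neg_mul,
      neg_add_cancel, Complex.exp_zero, one_mul]
  have hcoef : ‖⟪A γ, w⟫_ℂ - T * φ (γ.1 t₀)‖ < T * ε / E := by
    refine (norm_sub_le_norm_sub_add_norm_sub _ ⟪A γ, v⟫_ℂ _).trans_lt ?_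
    refine (add_lt_add_of_lt_of_le (hwv γ) (norm_inner_expAverage_sub_le hΦ hT.le hφ hv γ.2
      (rfl : (t₀ : ℝ) = 0))).trans_eq ?_
    rw [← hE]
    field_simp
    norm_num
  have hsplit : ⟪A γ, (T : ℂ)⁻¹ • w⟫_ℂ * Complex.exp (lam * ((t : ℝ) : ℂ)) - φ (γ.1 t) =
      (T : ℂ)⁻¹ * (⟪A γ, w⟫_ℂ - T * φ (γ.1 t₀)) * Complex.exp (lam * ((t : ℝ) : ℂ)) := by
    rw [hflow, inner_smul_right]
    field_simp
  refine (congrArg norm ((congrArg (· - φ (γ.1 t)) ht).trans hsplit)).trans_lt ?_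
  rw [norm_mul, norm_mul, norm_inv, Complex.norm_real, Real.norm_of_nonneg hT.le]
  calc T⁻¹ * ‖⟪A γ, w⟫_ℂ - T * φ (γ.1 t₀)‖ * ‖Complex.exp (lam * ((t : ℝ) : ℂ))‖
      ≤ T⁻¹ * ‖⟪A γ, w⟫_ℂ - T * φ (γ.1 t₀)‖ * E := by gcongr; exact norm_exp_mul_le lam t
    _ < T⁻¹ * (T * ε / E) * E := by gcongr
    _ = ε := by field_simp

/-- If finitely many curves meet only at equal times, and only where their coefficients agree, then
the functions `c i * exp(lam t)` along them come from one continuous function: they descend to the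
union of the curves, which is a compact quotient of `Fin N × [0, T]`, and extend by Tietze. -/
lemma exists_continuousMap_extending_exp {X : Type*} [TopologicalSpace X] [T2Space X]
    [NormalSpace X] {N : ℕ} (x : Fin N → C(TimeInterval T, X)) (c : Fin N → ℂ)
    (hc : ∀ i j s t, x i s = x j t → s = t ∧ c i = c j) :
    ∃ φ : C(X, ℂ), ∀ i t, φ (x i t) = c i * Complex.exp (lam * ((t : ℝ) : ℂ)) := by
  let p : Fin N × TimeInterval T → X := fun q => x q.1 q.2
  have hp : Continuous p := continuous_prod_of_discrete_left.2 fun i => (x i).continuous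
  let q : C(Fin N × TimeInterval T, Set.range p) := ⟨_, hp.rangeFactorization⟩
  have hq : Topology.IsQuotientMap q :=
    q.continuous.isClosedMap.isQuotientMap q.continuous Set.rangeFactorization_surjective
  let g : C(Fin N × TimeInterval T, ℂ) :=
    ⟨fun q => c q.1 * Complex.exp (lam * ((q.2 : ℝ) : ℂ)),
      continuous_prod_of_discrete_left.2 fun i => by fun_prop⟩
  have hg : Function.FactorsThrough g q := by
    rintro ⟨i, s⟩ ⟨j, t⟩ h
    obtain ⟨h₁, h₂⟩ := hc i j s t (congrArg Subtype.val h)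
    simp [g, h₁, h₂]
  obtain ⟨φ, hφ⟩ := ContinuousMap.exists_restrict_eq (isCompact_range hp).isClosed (hq.lift g hg)
  refine ⟨φ, fun i t => ?_⟩
  have h₁ := congr($hφ (q (i, t)))
  have h₂ := congr($(hq.lift_comp g hg) (i, t))
  exact h₁.trans h₂

/-- Over finitely many trajectories from a non-recurrent set of initial conditions, the outputs
`c γ * exp(lam ·)` are the values of a Koopman eigenfunction. The coefficient is a function of the
trajectory, so it agrees where two trajectories meet: non-recurrence forces them to coincide. -/
theorem exists_isKoopmanEigenfunction [T2Space X] [NormalSpace X]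
    (hX₀ : IsNonRecurrent F T X₀) {N : ℕ} (x : Fin N → trajectorySpace F T X X₀)
    (c : trajectorySpace F T X X₀ → ℂ) :
    ∃ φ : C(X, ℂ), (∀ i t, φ ((x i).1 t) = c (x i) * Complex.exp (lam * ((t : ℝ) : ℂ))) ∧
      IsKoopmanEigenfunction F T
        {x₀ : M | ∃ (i : Fin N) (t₀ : TimeInterval T), (t₀ : ℝ) = 0 ∧ x₀ = (x i).1 t₀} lam φ := by
  have hc : ∀ i j s t, (x i).1 s = (x j).1 t → s = t ∧ c (x i) = c (x j) := by
    intro i j s t hst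
    obtain ⟨a, ha, hxi⟩ := (x i).2
    obtain ⟨b, hb, hxj⟩ := (x j).2
    have h := congrArg Subtype.val hst
    rw [hxi, hxj] at h
    obtain ⟨h₁, h₂⟩ := hX₀ a ha b hb s t h
    refine ⟨h₁, congrArg c (Subtype.ext (ContinuousMap.ext fun r => Subtype.ext ?_))⟩
    rw [hxi, hxj, h₂]
  obtain ⟨φ, hφ⟩ := exists_continuousMap_extending_exp (lam := lam) (fun i => (x i).1)
    (fun i => c (x i)) hc
  refine ⟨φ, hφ, ?_⟩
  rintro a b t ⟨i, t₀, ht₀, ha⟩ hb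
  obtain ⟨x₀, -, hxi⟩ := (x i).2
  have ha' : a = (x i).1 t₀ := Subtype.ext ha
  have hb' : b = (x i).1 t := by
    refine Subtype.ext ?_
    rw [hb, hxi, ha, apply_eq_of_coe_eq_zero hxi ht₀]
  rw [ha', hb', hφ, hφ, ht₀, mul_left_comm, ← Complex.exp_add]
  simp

end

end KoopmanKernel

theorem theorem1 {M : Type u} [MetricSpace M] (F : Flow ℝ≥0 M) (X : Set M) (hX : IsCompact X)
    (X₀ : Set M) (T : ℝ) (hT : 0 < T) (k : X → X → ℝ) (hk : KoopmanKernel.IsUniversalKernel k)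
    (lam : ℂ) :
    ∃ (H : Type u) (_ : NormedAddCommGroup H) (_ : InnerProductSpace ℂ H) (_ : CompleteSpace H)
      (_ : RKHS ℂ H (KoopmanKernel.trajectorySpace F T X X₀) (KoopmanKernel.OutputSpace T)),
      -- (i) the kernel defines an RKHS: existence and uniqueness
      (RKHS.kernel H = KoopmanKernel.eigenKernel k lam (KoopmanKernel.trajectorySpace F T X X₀) ∧
        ∀ (H' : Type v) [NormedAddCommGroup H'] [InnerProductSpace ℂ H'] [CompleteSpace H']
          [RKHS ℂ H' (KoopmanKernel.trajectorySpace F T X X₀) (KoopmanKernel.OutputSpace T)],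
          RKHS.kernel H' =
            KoopmanKernel.eigenKernel k lam (KoopmanKernel.trajectorySpace F T X X₀) →
          ∃ Φ : H ≃ₗᵢ[ℂ] H', ∀ (h : H) (γ : KoopmanKernel.trajectorySpace F T X X₀), Φ h γ = h γ) ∧
      -- (ii) universality for the Koopman eigenfunctions with eigenvalue `lam`
      (∀ φ : C(X, ℂ), KoopmanKernel.IsKoopmanEigenfunction F T X₀ lam φ → ∀ ε : ℝ, 0 < ε →
        ∃ h ∈ KoopmanKernel.sectionSpan H, ∀ γ : KoopmanKernel.trajectorySpace F T X X₀,
          ∀ᵐ t : KoopmanKernel.TimeInterval T, ‖h γ t - φ (γ.1 t)‖ < ε) ∧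
      -- (iii) Koopman-invariance of the span of the sections at the data, over the data
      (∀ (N : ℕ) (x : Fin N → KoopmanKernel.trajectorySpace F T X X₀),
        (∀ h ∈ KoopmanKernel.dataSpan H x, ∀ i, KoopmanKernel.HasLTIDynamics lam (h (x i))) ∧
        (KoopmanKernel.IsNonRecurrent F T X₀ →
          ∀ h ∈ KoopmanKernel.dataSpan H x, ∃ φ : C(X, ℂ),
            (∀ i, h (x i) =ᵐ[volume] fun t => φ ((x i).1 t)) ∧
            KoopmanKernel.IsKoopmanEigenfunction F T
              {x₀ : M | ∃ (i : Fin N) (t₀ : KoopmanKernel.TimeInterval T),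
                (t₀ : ℝ) = 0 ∧ x₀ = (x i).1 t₀} lam φ)) := by
  obtain ⟨G, _, _, _, Φ, hΦ, hΦk⟩ := RKHS.exists_continuous_feature_map hk.continuous hk.posSemidef
  have : CompactSpace X := isCompact_iff_compactSpace.1 hX
  have hfac := KoopmanKernel.eigenKernel_eq hΦ hΦk lam (KoopmanKernel.trajectorySpace F T X X₀)
  have : Fact
      (KoopmanKernel.eigenKernel k lam (KoopmanKernel.trajectorySpace F T X X₀)).PosSemidef :=
    ⟨RKHS.posSemidef_of_features _ hfac⟩
  let H := RKHS.OfKernel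
    (KoopmanKernel.eigenKernel k lam (KoopmanKernel.trajectorySpace F T X X₀))
  have hK : RKHS.kernel H =
      KoopmanKernel.eigenKernel k lam (KoopmanKernel.trajectorySpace F T X X₀) :=
    RKHS.OfKernel.kernel_ofKernel
  have hval : ∀ {N : ℕ} {x : Fin N → KoopmanKernel.trajectorySpace F T X X₀} {h : H},
      h ∈ KoopmanKernel.dataSpan H x → ∀ γ, ∃ c : ℂ, h γ = c • KoopmanKernel.expOutput T lam :=
    fun hh => KoopmanKernel.exists_eq_smul_expOutput_of_mem_dataSpan
      (fun γ γ' => by rw [hK, hfac]) hh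
  refine ⟨H, inferInstance, inferInstance, inferInstance, inferInstance, ⟨hK, ?_⟩, ?_, ?_⟩
  · intro H' _ _ _ _ hH'
    exact RKHS.exists_linearIsometryEquiv_of_kernel_eq (hH'.trans hK.symm)
  · intro φ hφ ε hε
    exact KoopmanKernel.exists_mem_sectionSpan_norm_sub_lt hT hk hΦ hΦk hK hφ hε
  · refine fun N x => ⟨fun h hh i => ?_, fun hX₀ h hh => ?_⟩
    · obtain ⟨c, hc⟩ := hval hh (x i)
      rw [hc]
      exact KoopmanKernel.hasLTIDynamics_smul_expOutput lam c
    · choose c hc using hval hh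
      obtain ⟨φ, hφ, hφK⟩ :=
        KoopmanKernel.exists_isKoopmanEigenfunction (lam := lam) hX₀ x c
      refine ⟨φ, fun i => ?_, hφK⟩
      rw [hc]
      simpa only [hφ] using KoopmanKernel.coeFn_smul_expOutput lam (c (x i))
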